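/- Let $k\ge 1$, $n\ge 3k+2$, $R>0$ and $D>0$. Equip $\mathbb R^n\times\mathbb R^n$ with the Euclidean norm, write $z=(x,y)$, and call a differentiable function $L:\mathbb R^n\times\mathbb R^n\to\mathbb R$ $R$-smooth if its saddle operator $z\mapsto(\nabla_xL(z),-\nabla_yL(z))$ is $R$-Lipschitz, and biaffine if it is affine in $x$ for each fixed $y$ and affine in $y$ for each fixed $x$. A saddle point of $L$ is a point $(x^\star,y^\star)$ with $L(x^\star,y)\le L(x^\star,y^\star)\le L(x,y^\star)$ for all $x,y\in\mathbb R^n$. A deterministic black-box gradient-based algorithm $\mathcal A$ is a sequence of arbitrary functions $\mathcal A_1,\mathcal A_2,\dots$; started at a point $z^0$ on an objective $L$, it produces inquiry points $z^i$ and approximate solutions $\bar z^i$ by $$(z^i,\bar z^i)=\mathcal A_i\bigl(z^0,\nabla L(z^0),\dots,\nabla L(z^{i-1})\bigr),\qquad i\ge 1,\qquad \nabla L=(\nabla_xL,\nabla_yL)$$ (no linear-span assumption is made). For every such algorithm $\mathcal A$ and every initial point $z^0\in\mathbb R^n\times\mathbb R^n$ there exists an $R$-smooth biaffine function $L$ on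 $\mathbb R^n\times\mathbb R^n$ that has a saddle point, such that, with $z^\star$ denoting its saddle point closest to $z^0$, $\|z^0-z^\star\|=D$ and the $k$-th inquiry point $z^k$ produced by $\mathcal A$ from $z^0$ on $L$ satisfies $$\|\nabla L(z^k)\|^2\ \ge\ \frac{R^2\,\|z^0-z^\star\|^2}{(2\lfloor k/2\rfloor+1)^2}.$$ Likewise, there exists such an $L$ (possibly a different one) for which the same bound holds with the $k$-th approximate solution $\bar z^k$ in place of $z^k$. -/

import Mathlib

/-- The Euclidean space `ℝⁿ`. -/
abbrev Vec (n : ℕ) : Type := EuclideanSpace ℝ (Fin n)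

/-- The space `ℝⁿ × ℝⁿ` of points `z = (x, y)`, with the Euclidean norm
`‖z‖² = ‖x‖² + ‖y‖²`. -/
abbrev Pt (n : ℕ) : Type := WithLp 2 (Vec n × Vec n)

/-- The point `(x, y)` of `ℝⁿ × ℝⁿ`. -/
def mkPt {n : ℕ} (x y : Vec n) : Pt n := WithLp.toLp 2 (x, y)

noncomputable section

/-- The partial gradient `∇ₓ L (x, y)`. -/
def gradX {n : ℕ} (L : Pt n → ℝ) (z : Pt n) : Vec n :=
  gradient (fun x : Vec n => L (mkPt x z.snd)) z.fst

/-- The partial gradient `∇_y L (x, y)`. -/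
def gradY {n : ℕ} (L : Pt n → ℝ) (z : Pt n) : Vec n :=
  gradient (fun y : Vec n => L (mkPt z.fst y)) z.snd

/-- The gradient oracle `𝒪(z; L) = ∇L(z) = (∇ₓ L(x, y), ∇_y L(x, y))`. -/
def gradOracle {n : ℕ} (L : Pt n → ℝ) (z : Pt n) : Pt n :=
  mkPt (gradX L z) (gradY L z)

/-- The saddle operator `G_L(z) = (∇ₓ L(x, y), -∇_y L(x, y))`. -/
def saddleOp {n : ℕ} (L : Pt n → ℝ) (z : Pt n) : Pt n :=
  mkPt (gradX L z) (-gradY L z)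

/-- `L` is `R`-smooth: it is differentiable and its saddle operator is `R`-Lipschitz. -/
def IsSmoothSaddle {n : ℕ} (R : ℝ) (L : Pt n → ℝ) : Prop :=
  Differentiable ℝ L ∧ ∀ z w : Pt n, ‖saddleOp L z - saddleOp L w‖ ≤ R * ‖z - w‖

/-- `L` is biaffine: affine in `x` for each fixed `y`, and affine in `y` for each fixed `x`. -/
def IsBiaffine {n : ℕ} (L : Pt n → ℝ) : Prop :=
  (∀ y : Vec n, ∃ f : Vec n →ᵃ[ℝ] ℝ, ∀ x : Vec n, L (mkPt x y) = f x) ∧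
  (∀ x : Vec n, ∃ f : Vec n →ᵃ[ℝ] ℝ, ∀ y : Vec n, L (mkPt x y) = f y)

/-- `zs = (xs, ys)` is a saddle point: `L(xs, y) ≤ L(xs, ys) ≤ L(x, ys)` for all `x`, `y`. -/
def IsSaddlePt {n : ℕ} (L : Pt n → ℝ) (zs : Pt n) : Prop :=
  (∀ y : Vec n, L (mkPt zs.fst y) ≤ L zs) ∧ (∀ x : Vec n, L zs ≤ L (mkPt x zs.snd))

/-- `zs` is a saddle point of `L` that is closest to `z₀` among all saddle points of `L`. -/
def IsClosestSaddlePt {n : ℕ} (L : Pt n → ℝ) (z₀ zs : Pt n) : Prop :=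
  IsSaddlePt L zs ∧ ∀ w : Pt n, IsSaddlePt L w → ‖z₀ - zs‖ ≤ ‖z₀ - w‖

/-- A deterministic black-box gradient-based algorithm on `ℝⁿ × ℝⁿ`: a sequence of arbitrary
functions `𝒜₁, 𝒜₂, …`, where `𝒜ᵢ` takes the initial point and the oracle answers at the inquiry
points `z⁰, …, zⁱ⁻¹` and returns the next inquiry point and approximate solution `(zⁱ, z̄ⁱ)`.
The function `𝒜ᵢ₊₁` is stored at index `i`. -/
abbrev BlackBoxAlgorithm (n : ℕ) : Type :=
  (i : ℕ) → Pt n → (Fin (i + 1) → Pt n) → Pt n × Pt n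

/-- The pair `(zⁱ, z̄ⁱ)` produced by the algorithm from `z₀` on the objective `L`
(for `i = 0` both are `z₀`). -/
def BlackBoxAlgorithm.run {n : ℕ} (A : BlackBoxAlgorithm n) (L : Pt n → ℝ) (z₀ : Pt n) :
    ℕ → Pt n × Pt n
  | 0 => (z₀, z₀)
  | i + 1 => A i z₀ (fun j : Fin (i + 1) => gradOracle L (BlackBoxAlgorithm.run A L z₀ j.val).1)
termination_by i => i
decreasing_by exact j.isLt

/-- The `i`-th inquiry point `zⁱ`. -/
def BlackBoxAlgorithm.inquiry {n : ℕ} (A : BlackBoxAlgorithm n) (L : Pt n → ℝ) (z₀ : Pt n)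
    (i : ℕ) : Pt n :=
  (BlackBoxAlgorithm.run A L z₀ i).1

/-- The `i`-th approximate solution `z̄ⁱ`. -/
def BlackBoxAlgorithm.approx {n : ℕ} (A : BlackBoxAlgorithm n) (L : Pt n → ℝ) (z₀ : Pt n)
    (i : ℕ) : Pt n :=
  (BlackBoxAlgorithm.run A L z₀ i).2

end

/-! The hard objective couples consecutive members of an orthogonal chain `F 0, …, F m`, `m = 2⌊k/2⌋
+ 1`, and subtracts a linear term along `F 0`; its gradient is `T (z - z₀) - γ • F 0` with `T =
chainOp m (R / 2) F`. Members alternate between the two factors, so the objective is biaffine and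
its saddle points are the zeros of the gradient. Squared lengths `2, 1, …, 1, 2` keep `‖T‖ ≤ R`
(`norm_chainOp_le`).

An adversary builds the chain along the run: `F l` is orthogonal to the displacements of queries `0,
…, l`, and for `l ≥ k` also to that of the `k`-th approximate solution (`exists_isResistingChain`).
As `m ≥ k`, both outputs at step `k` miss `F m`.

Two vectors give the constant, with inner products `cos (jπ/2)` and `sin (jπ/2)` against `F j`. `T`
sends the first to a multiple of `F m`, so pairing it with the gradient leaves only `-γ`
(`sq_le_norm_chainOp_sub`). `T` sends the second to a multiple of `F 0`, so rescaling it gives the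
closest saddle point (`exists_minNorm_chainOp_eq`). Both have squared norm `m / 2`, whence the ratio
`R / m`. -/

/-! ### Biaffine quadratic objectives and their saddle points. -/

/-- The quadratic function `½⟪T w, w⟫ - ⟪b, w⟫` of `w = z - z₀`. -/
noncomputable def quadObj {n : ℕ} (T : Pt n →L[ℝ] Pt n) (b z₀ z : Pt n) : ℝ :=
  1 / 2 * inner ℝ (T (z - z₀)) (z - z₀) - inner ℝ b (z - z₀)

/-- `T` is symmetric with vanishing diagonal blocks, so that `½⟪T z, z⟫` is bilinear in `(x, y)`. -/
structure IsOffDiagonal {n : ℕ} (T : Pt n →L[ℝ] Pt n) : Prop where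
  symm : ∀ z w, inner ℝ (T z) w = inner ℝ z (T w)
  fst : ∀ x, inner ℝ (T (mkPt x 0)) (mkPt x 0) = 0
  snd : ∀ y, inner ℝ (T (mkPt 0 y)) (mkPt 0 y) = 0

theorem inner_mkPt_zero_right {n : ℕ} (z : Pt n) (x : Vec n) :
    inner ℝ z (mkPt x 0) = inner ℝ z.fst x := by
  simp [mkPt, WithLp.prod_inner_apply]

theorem inner_mkPt_zero_left {n : ℕ} (z : Pt n) (y : Vec n) :
    inner ℝ z (mkPt 0 y) = inner ℝ z.snd y := by
  simp [mkPt, WithLp.prod_inner_apply]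

theorem mkPt_eq_add_fst {n : ℕ} (z : Pt n) (x : Vec n) :
    mkPt x z.snd = z + mkPt (x - z.fst) 0 := by
  apply (WithLp.equiv 2 _).injective
  ext i <;> simp [mkPt]

theorem mkPt_eq_add_snd {n : ℕ} (z : Pt n) (y : Vec n) :
    mkPt z.fst y = z + mkPt 0 (y - z.snd) := by
  apply (WithLp.equiv 2 _).injective
  ext i <;> simp [mkPt]

namespace IsOffDiagonal

variable {n : ℕ} {T : Pt n →L[ℝ] Pt n} (hT : IsOffDiagonal T) (b z₀ : Pt n)
include hT

theorem quadObj_add (z h : Pt n) : quadObj T b z₀ (z + h) =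
    quadObj T b z₀ z + inner ℝ (T (z - z₀) - b) h + 1 / 2 * inner ℝ (T h) h := by
  have e : z + h - z₀ = (z - z₀) + h := by abel
  simp only [quadObj, e, map_add, inner_add_left, inner_add_right, inner_sub_left]
  rw [hT.symm h (z - z₀), real_inner_comm h]
  ring

theorem quadObj_mkPt_fst (z : Pt n) (x : Vec n) : quadObj T b z₀ (mkPt x z.snd) =
    quadObj T b z₀ z + inner ℝ (T (z - z₀) - b).fst (x - z.fst) := by
  rw [mkPt_eq_add_fst, hT.quadObj_add, hT.fst, inner_mkPt_zero_right]
  ring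

theorem quadObj_mkPt_snd (z : Pt n) (y : Vec n) : quadObj T b z₀ (mkPt z.fst y) =
    quadObj T b z₀ z + inner ℝ (T (z - z₀) - b).snd (y - z.snd) := by
  rw [mkPt_eq_add_snd, hT.quadObj_add, hT.snd, inner_mkPt_zero_left]
  ring

omit hT in
theorem hasGradientAt_affine (c : ℝ) (g x₀ x : Vec n) :
    HasGradientAt (fun x => c + inner ℝ g (x - x₀)) g x := by
  rw [hasGradientAt_iff_hasFDerivAt]
  exact (((InnerProductSpace.toDual ℝ (Vec n) g).hasFDerivAt.comp x
    ((hasFDerivAt_id x).sub_const x₀)).const_add c)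

theorem gradOracle_quadObj (z : Pt n) : gradOracle (quadObj T b z₀) z = T (z - z₀) - b := by
  have h1 : gradX (quadObj T b z₀) z = (T (z - z₀) - b).fst := by
    simp only [gradX, hT.quadObj_mkPt_fst]
    exact (hasGradientAt_affine _ _ _ _).gradient
  have h2 : gradY (quadObj T b z₀) z = (T (z - z₀) - b).snd := by
    simp only [gradY, hT.quadObj_mkPt_snd]
    exact (hasGradientAt_affine _ _ _ _).gradient
  rw [gradOracle, h1, h2]
  rfl

theorem isBiaffine_quadObj : IsBiaffine (quadObj T b z₀) := by
  constructor
  · intro y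
    refine ⟨(innerₗ (Vec n) (T (mkPt 0 y - z₀) - b).fst).toAffineMap +
      AffineMap.const ℝ _ (quadObj T b z₀ (mkPt 0 y)), fun x => ?_⟩
    have h := hT.quadObj_mkPt_fst b z₀ (mkPt 0 y) x
    change quadObj T b z₀ (mkPt x y) = _ + inner ℝ _ (x - 0) at h
    rw [h, sub_zero, add_comm]
    rfl
  · intro x
    refine ⟨(innerₗ (Vec n) (T (mkPt x 0 - z₀) - b).snd).toAffineMap +
      AffineMap.const ℝ _ (quadObj T b z₀ (mkPt x 0)), fun y => ?_⟩
    have h := hT.quadObj_mkPt_snd b z₀ (mkPt x 0) y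
    change quadObj T b z₀ (mkPt x y) = _ + inner ℝ _ (y - 0) at h
    rw [h, sub_zero, add_comm]
    rfl

theorem isSmoothSaddle_quadObj {R : ℝ} (hR : ∀ z, ‖T z‖ ≤ R * ‖z‖) :
    IsSmoothSaddle R (quadObj T b z₀) := by
  constructor
  · have hs : Differentiable ℝ (fun z : Pt n => z - z₀) := differentiable_id.sub_const z₀
    have hc : Differentiable ℝ (fun z : Pt n => T (z - z₀)) := T.differentiable.comp hs
    have h1 : Differentiable ℝ (fun z : Pt n => inner ℝ (T (z - z₀)) (z - z₀)) := hc.inner ℝ hs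
    have h2 : Differentiable ℝ (fun z : Pt n => inner ℝ b (z - z₀)) :=
      (differentiable_const b).inner ℝ hs
    exact (h1.const_mul (1 / 2)).sub h2
  · intro z w
    have hX : ∀ z, gradX (quadObj T b z₀) z = (T (z - z₀) - b).fst := fun z =>
      congrArg WithLp.fst (hT.gradOracle_quadObj b z₀ z)
    have hY : ∀ z, gradY (quadObj T b z₀) z = (T (z - z₀) - b).snd := fun z =>
      congrArg WithLp.snd (hT.gradOracle_quadObj b z₀ z)
    have hd : T (z - z₀) - T (w - z₀) = T (z - w) := by rw [← map_sub]; congr 1; abel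
    -- The saddle operator differs from the gradient by a sign in one component, which norms of
    -- differences do not see.
    have : ‖saddleOp (quadObj T b z₀) z - saddleOp (quadObj T b z₀) w‖ = ‖T (z - w)‖ := by
      have e1 : (saddleOp (quadObj T b z₀) z - saddleOp (quadObj T b z₀) w).fst =
          (T (z - w)).fst := by
        change gradX (quadObj T b z₀) z - gradX (quadObj T b z₀) w = _
        rw [← hd, hX, hX, WithLp.sub_fst, WithLp.sub_fst, WithLp.sub_fst]
        abel
      have e2 : (saddleOp (quadObj T b z₀) z - saddleOp (quadObj T b z₀) w).snd =
          -(T (z - w)).snd := by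
        change -gradY (quadObj T b z₀) z - -gradY (quadObj T b z₀) w = _
        rw [← hd, hY, hY, WithLp.sub_snd, WithLp.sub_snd, WithLp.sub_snd]
        abel
      rw [← sq_eq_sq₀ (norm_nonneg _) (norm_nonneg _), WithLp.prod_norm_sq_eq_of_L2,
        WithLp.prod_norm_sq_eq_of_L2, e1, e2, norm_neg]
    rw [this]
    exact hR _

theorem isSaddlePt_of_map_eq {z : Pt n} (hz : T (z - z₀) = b) :
    IsSaddlePt (quadObj T b z₀) z := by
  constructor
  · intro y; rw [hT.quadObj_mkPt_snd, hz]; simp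
  · intro x; rw [hT.quadObj_mkPt_fst, hz]; simp

theorem map_eq_of_isSaddlePt {z : Pt n} (hz : IsSaddlePt (quadObj T b z₀) z) :
    T (z - z₀) = b := by
  have h1 : (T (z - z₀) - b).fst = 0 := by
    -- A step against the gradient lowers the affine slice by its squared norm, so minimality forces
    -- it to vanish.
    have h := hz.2 (z.fst - (T (z - z₀) - b).fst)
    rw [hT.quadObj_mkPt_fst, sub_sub_cancel_left, inner_neg_right] at h
    rw [real_inner_self_eq_norm_sq] at h
    rw [← norm_eq_zero]
    nlinarith
  have h2 : (T (z - z₀) - b).snd = 0 := by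
    have h := hz.1 (z.snd + (T (z - z₀) - b).snd)
    rw [hT.quadObj_mkPt_snd, add_sub_cancel_left] at h
    rw [real_inner_self_eq_norm_sq] at h
    rw [← norm_eq_zero]
    nlinarith
  rw [← sub_eq_zero]
  apply (WithLp.equiv 2 _).injective
  exact Prod.ext h1 h2

end IsOffDiagonal

/-! ### Orthogonal chains and the operator coupling neighbours. -/

section Chain

variable {E : Type*} [NormedAddCommGroup E] [InnerProductSpace ℝ E]

/-- The operator `z ↦ ρ ∑ (⟪F j, z⟫ F (j + 1) + ⟪F (j + 1), z⟫ F j)` coupling consecutive members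
of the family `F`. -/
noncomputable def chainOp (m : ℕ) (ρ : ℝ) (F : ℕ → E) : E →L[ℝ] E :=
  ρ • ∑ j ∈ Finset.range m,
    ((innerSL ℝ (F j)).smulRight (F (j + 1)) + (innerSL ℝ (F (j + 1))).smulRight (F j))

theorem chainOp_apply (m : ℕ) (ρ : ℝ) (F : ℕ → E) (z : E) :
    chainOp m ρ F z = ρ • ∑ j ∈ Finset.range m,
      (inner ℝ (F j) z • F (j + 1) + inner ℝ (F (j + 1)) z • F j) := by
  simp [chainOp]

theorem inner_chainOp (m : ℕ) (ρ : ℝ) (F : ℕ → E) (z w : E) :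
    inner ℝ (chainOp m ρ F z) w = ρ * ∑ j ∈ Finset.range m,
      (inner ℝ (F j) z * inner ℝ (F (j + 1)) w + inner ℝ (F (j + 1)) z * inner ℝ (F j) w) := by
  rw [chainOp_apply, inner_smul_left, sum_inner]
  simp [inner_add_left, inner_smul_left]

theorem inner_chainOp_comm (m : ℕ) (ρ : ℝ) (F : ℕ → E) (z w : E) :
    inner ℝ (chainOp m ρ F z) w = inner ℝ z (chainOp m ρ F w) := by
  rw [← real_inner_comm z, inner_chainOp, inner_chainOp]
  congr 1
  exact Finset.sum_congr rfl fun j _ => by ring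

/-- Squared lengths of the members of a chain. -/
def chainWeight (m j : ℕ) : ℝ := if j = 0 ∨ j = m then 2 else 1

theorem chainWeight_pos (m j : ℕ) : 0 < chainWeight m j := by
  unfold chainWeight; split_ifs <;> norm_num

/-- An orthogonal family `F 0, …, F m` with squared lengths `2, 1, …, 1, 2`. -/
structure IsOrthogonalChain (m : ℕ) (F : ℕ → E) : Prop where
  orth : ∀ i j, i ≠ j → inner ℝ (F i) (F j) = 0
  inner_self : ∀ j ≤ m, inner ℝ (F j) (F j) = chainWeight m j

/-- The vector with prescribed inner products `p j` against the chain `F`. -/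
noncomputable def chainVec (m : ℕ) (F : ℕ → E) (p : ℕ → ℝ) : E :=
  ∑ j ∈ Finset.range (m + 1), (p j / chainWeight m j) • F j

theorem inner_chainVec_left (m : ℕ) (F : ℕ → E) (p : ℕ → ℝ) (z : E) :
    inner ℝ (chainVec m F p) z =
      ∑ j ∈ Finset.range (m + 1), p j / chainWeight m j * inner ℝ (F j) z := by
  simp [chainVec, sum_inner, inner_smul_left]

/-- Each interior `F (j + 1)` collects `p j` and `p (j + 2)`, which cancel. -/
theorem sum_range_two_step {M : Type*} [AddCommGroup M] [Module ℝ M] (p : ℕ → ℝ)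
    (hp : ∀ j, p (j + 2) = -p j) (F : ℕ → M) (J : ℕ) :
    ∑ j ∈ Finset.range (J + 1), (p j • F (j + 1) + p (j + 1) • F j) =
      p 1 • F 0 + p J • F (J + 1) := by
  induction J with
  | zero => simp [add_comm]
  | succ J ih => rw [Finset.sum_range_succ, ih, hp J, neg_smul]; abel

theorem sum_range_chainWeight (r : ℕ) (f : ℕ → ℝ) :
    ∑ j ∈ Finset.range (2 * r + 1 + 1), f j / chainWeight (2 * r + 1) j =
      f 0 / 2 + ∑ j ∈ Finset.range (2 * r), f (j + 1) + f (2 * r + 1) / 2 := by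
  rw [Finset.sum_range_succ, Finset.sum_range_succ', add_comm (f 0 / 2)]
  congr 2
  · refine Finset.sum_congr rfl fun j hj => ?_
    have := Finset.mem_range.1 hj
    rw [chainWeight, if_neg (by omega), div_one]
  · simp [chainWeight]

theorem sum_range_two_mul_of_add_eq_one {f : ℕ → ℝ} (hf : ∀ j, f j + f (j + 1) = 1) (r : ℕ) :
    ∑ j ∈ Finset.range (2 * r), f (j + 1) = r := by
  induction r with
  | zero => simp
  | succ r ih =>
    rw [show 2 * (r + 1) = 2 * r + 1 + 1 by ring, Finset.sum_range_succ, Finset.sum_range_succ, ih,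
      add_assoc, hf]
    push_cast; ring

/-- The two halved end terms add up to `1 / 2`; the interior splits into `r` neighbouring pairs of
sum one. -/
theorem sum_sq_div_chainWeight {p : ℕ → ℝ} (hp : ∀ j, p j ^ 2 + p (j + 1) ^ 2 = 1) (r : ℕ) :
    ∑ j ∈ Finset.range (2 * r + 1 + 1), p j / chainWeight (2 * r + 1) j * p j =
      (2 * r + 1) / 2 := by
  have h := sum_range_chainWeight r fun j => p j ^ 2
  rw [sum_range_two_mul_of_add_eq_one hp] at h
  have h2 : p 0 ^ 2 + p (2 * r + 1) ^ 2 = 1 := by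
    clear h
    have : p (2 * r + 1) ^ 2 = p 1 ^ 2 := by
      induction r with
      | zero => rfl
      | succ r ih =>
        rw [← ih, mul_add]
        linarith [hp (2 * r + 1), hp (2 * r + 2)]
    rw [this, hp]
  calc _ = ∑ j ∈ Finset.range (2 * r + 1 + 1), p j ^ 2 / chainWeight (2 * r + 1) j :=
        Finset.sum_congr rfl fun j _ => by ring
    _ = _ := by rw [h]; linarith

namespace IsOrthogonalChain

variable {m : ℕ} {F : ℕ → E} (hF : IsOrthogonalChain m F)
include hF

theorem inner_chainVec (p : ℕ → ℝ) {i : ℕ} (hi : i ≤ m) :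
    inner ℝ (F i) (chainVec m F p) = p i := by
  rw [real_inner_comm, inner_chainVec_left, Finset.sum_eq_single i]
  · rw [hF.inner_self i hi, div_mul_cancel₀ _ (chainWeight_pos m i).ne']
  · intro j _ hj; rw [hF.orth j i hj, mul_zero]
  · intro h; exact absurd (Finset.mem_range.2 (by omega)) h

theorem inner_chainVec_chainVec (p q : ℕ → ℝ) :
    inner ℝ (chainVec m F p) (chainVec m F q) =
      ∑ j ∈ Finset.range (m + 1), p j / chainWeight m j * q j := by
  rw [inner_chainVec_left]
  refine Finset.sum_congr rfl fun j hj => ?_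
  rw [hF.inner_chainVec q (Nat.le_of_lt_succ (Finset.mem_range.1 hj))]

theorem bessel (z : E) :
    ∑ j ∈ Finset.range (m + 1), inner ℝ (F j) z ^ 2 / chainWeight m j ≤ ‖z‖ ^ 2 := by
  set v := chainVec m F (fun j => inner ℝ (F j) z) with hv
  have h1 : inner ℝ v z = ∑ j ∈ Finset.range (m + 1), inner ℝ (F j) z ^ 2 / chainWeight m j := by
    rw [hv, inner_chainVec_left]
    exact Finset.sum_congr rfl fun j _ => by ring
  have h2 : inner ℝ v v = ∑ j ∈ Finset.range (m + 1), inner ℝ (F j) z ^ 2 / chainWeight m j := by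
    rw [hv, hF.inner_chainVec_chainVec]
    exact Finset.sum_congr rfl fun j _ => by ring
  have h3 : 0 ≤ inner ℝ (z - v) (z - v) := real_inner_self_nonneg
  rw [inner_sub_left, inner_sub_right, inner_sub_right, real_inner_comm v z, h1, h2,
    real_inner_self_eq_norm_sq] at h3
  linarith

theorem chainOp_chainVec {J : ℕ} (hm : m = J + 1) (ρ : ℝ) {p : ℕ → ℝ}
    (hp : ∀ j, p (j + 2) = -p j) :
    chainOp m ρ F (chainVec m F p) = ρ • (p 1 • F 0 + p J • F m) := by
  rw [chainOp_apply, hm, ← sum_range_two_step p hp, ← hm]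
  congr 1
  refine Finset.sum_congr rfl fun j hj => ?_
  have := Finset.mem_range.1 hj
  rw [hF.inner_chainVec p (by omega), hF.inner_chainVec p (by omega)]

/-- Pairing `chainOp m ρ F h` with an interior member isolates its two neighbours. -/
theorem inner_add_inner_of_chainOp_eq_zero {ρ : ℝ} (hρ : ρ ≠ 0) {h : E}
    (hh : chainOp m ρ F h = 0) {l : ℕ} (hl : l + 1 < m) :
    inner ℝ (F l) h + inner ℝ (F (l + 2)) h = 0 := by
  have e := inner_chainOp m ρ F h (F (l + 1))
  rw [hh, inner_zero_left, Finset.sum_add_distrib, Finset.sum_eq_single l,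
    Finset.sum_eq_single (l + 1), hF.inner_self _ hl.le, ← add_mul] at e
  · have := (chainWeight_pos m (l + 1)).ne'
    simpa [hρ, this] using e.symm
  · intro j _ hj; rw [hF.orth _ _ hj, mul_zero]
  · intro h; exact absurd (Finset.mem_range.2 hl) h
  · intro j _ hj; rw [hF.orth _ _ (by omega), mul_zero]
  · intro h; exact absurd (Finset.mem_range.2 (by omega)) h

theorem inner_one_of_chainOp_eq_zero {ρ : ℝ} (hρ : ρ ≠ 0) {h : E}
    (hh : chainOp m ρ F h = 0) (hm : 0 < m) : inner ℝ (F 1) h = 0 := by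
  have e := inner_chainOp m ρ F h (F 0)
  rw [hh, inner_zero_left, Finset.sum_add_distrib, Finset.sum_eq_zero, zero_add,
    Finset.sum_eq_single 0, hF.inner_self _ hm.le] at e
  · have := (chainWeight_pos m 0).ne'
    simpa [hρ, this] using e.symm
  · intro j _ hj; rw [hF.orth _ _ hj, mul_zero]
  · intro h; exact absurd (Finset.mem_range.2 hm) h
  · intro j _; rw [hF.orth _ _ (by omega), mul_zero]

theorem inner_odd_of_chainOp_eq_zero {ρ : ℝ} (hρ : ρ ≠ 0) {h : E}
    (hh : chainOp m ρ F h = 0) (i : ℕ) (hi : 2 * i + 1 ≤ m) :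
    inner ℝ (F (2 * i + 1)) h = 0 := by
  induction i with
  | zero => exact hF.inner_one_of_chainOp_eq_zero hρ hh hi
  | succ i ih =>
    have e := hF.inner_add_inner_of_chainOp_eq_zero hρ hh (l := 2 * i + 1) (by omega)
    rwa [ih (by omega), zero_add] at e

end IsOrthogonalChain

/-- End members occur in one coupling and interior ones in two; length `2` at the ends compensates,
so Bessel bounds the sum over couplings by `2 * ‖z‖ ^ 2`. -/
theorem IsOrthogonalChain.norm_chainOp_le {r : ℕ} {F : ℕ → E} (hF : IsOrthogonalChain (2 * r + 1) F) {R : ℝ}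
    (hR : 0 < R) (z : E) : ‖chainOp (2 * r + 1) (R / 2) F z‖ ≤ R * ‖z‖ := by
  have key : ∀ z : E, ∑ j ∈ Finset.range (2 * r + 1),
      (inner ℝ (F j) z ^ 2 + inner ℝ (F (j + 1)) z ^ 2) ≤ 2 * ‖z‖ ^ 2 := by
    intro z
    have h := hF.bessel z
    rw [sum_range_chainWeight r fun j => inner ℝ (F j) z ^ 2] at h
    rw [Finset.sum_add_distrib, Finset.sum_range_succ', Finset.sum_range_succ]
    linarith
  have bound : ∀ v : E,
      inner ℝ (chainOp (2 * r + 1) (R / 2) F z) v ≤ R / 2 * (‖z‖ ^ 2 + ‖v‖ ^ 2) := by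
    intro v
    rw [inner_chainOp]
    refine mul_le_mul_of_nonneg_left ?_ (by positivity)
    have h : ∑ j ∈ Finset.range (2 * r + 1), (inner ℝ (F j) z * inner ℝ (F (j + 1)) v +
        inner ℝ (F (j + 1)) z * inner ℝ (F j) v) ≤
        ∑ j ∈ Finset.range (2 * r + 1), (1 / 2 * (inner ℝ (F j) z ^ 2 +
          inner ℝ (F (j + 1)) z ^ 2) + 1 / 2 * (inner ℝ (F j) v ^ 2 + inner ℝ (F (j + 1)) v ^ 2)) := by
      refine Finset.sum_le_sum fun j _ => ?_
      nlinarith [sq_nonneg (inner ℝ (F j) z - inner ℝ (F (j + 1)) v),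
        sq_nonneg (inner ℝ (F (j + 1)) z - inner ℝ (F j) v)]
    rw [Finset.sum_add_distrib (f := fun j => 1 / 2 * (_ : ℝ)), ← Finset.mul_sum,
      ← Finset.mul_sum] at h
    linarith [key z, key v]
  set w := chainOp (2 * r + 1) (R / 2) F z
  -- This scaling of the test vector balances the two squares in `bound`, so half of `‖w‖ ^ 2` can
  -- be absorbed.
  have h := bound (R⁻¹ • w)
  rw [inner_smul_right, real_inner_self_eq_norm_sq, norm_smul, Real.norm_of_nonneg (by positivity),
    mul_pow] at h
  have h2 : ‖w‖ ^ 2 ≤ (R * ‖z‖) ^ 2 := by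
    have e : R * (R⁻¹ * ‖w‖ ^ 2) = ‖w‖ ^ 2 := by field_simp
    have e2 : R * (R / 2 * (‖z‖ ^ 2 + R⁻¹ ^ 2 * ‖w‖ ^ 2)) =
      ((R * ‖z‖) ^ 2 + ‖w‖ ^ 2) / 2 := by field_simp
    have := mul_le_mul_of_nonneg_left h hR.le
    rw [e, e2] at this
    linarith
  exact (sq_le_sq₀ (norm_nonneg _) (by positivity)).1 h2

end Chain

/-! ### Alternating chains and the two extremal vectors. -/

/-- The members of `F` lie alternately in `0 × ℝⁿ` and in `ℝⁿ × 0`. -/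
structure IsAlternating {n : ℕ} (F : ℕ → Pt n) : Prop where
  even : ∀ j, Even j → (F j).fst = 0
  odd : ∀ j, Odd j → (F j).snd = 0

theorem IsAlternating.isOffDiagonal {n : ℕ} {F : ℕ → Pt n} (hF : IsAlternating F) (m : ℕ)
    (ρ : ℝ) : IsOffDiagonal (chainOp m ρ F) where
  symm := inner_chainOp_comm m ρ F
  fst x := by
    rw [inner_chainOp, Finset.sum_eq_zero, mul_zero]
    intro j _
    simp only [inner_mkPt_zero_right]
    rcases Nat.even_or_odd j with h | h
    · simp [hF.even j h]
    · simp [hF.even (j + 1) h.add_one]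
  snd y := by
    rw [inner_chainOp, Finset.sum_eq_zero, mul_zero]
    intro j _
    simp only [inner_mkPt_zero_left]
    rcases Nat.even_or_odd j with h | h
    · simp [hF.odd (j + 1) h.add_one]
    · simp [hF.odd j h]

theorem cos_add_two_mul_pi_div_two (j : ℕ) :
    Real.cos (((j + 2 : ℕ) : ℝ) * (Real.pi / 2)) = -Real.cos (j * (Real.pi / 2)) := by
  rw [← Real.cos_add_pi]; congr 1; push_cast; ring

theorem sin_add_two_mul_pi_div_two (j : ℕ) :
    Real.sin (((j + 2 : ℕ) : ℝ) * (Real.pi / 2)) = -Real.sin (j * (Real.pi / 2)) := by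
  rw [← Real.sin_add_pi]; congr 1; push_cast; ring

theorem cos_succ_mul_pi_div_two (j : ℕ) :
    Real.cos (((j + 1 : ℕ) : ℝ) * (Real.pi / 2)) = -Real.sin (j * (Real.pi / 2)) := by
  rw [← Real.cos_add_pi_div_two]; congr 1; push_cast; ring

theorem sin_succ_mul_pi_div_two (j : ℕ) :
    Real.sin (((j + 1 : ℕ) : ℝ) * (Real.pi / 2)) = Real.cos (j * (Real.pi / 2)) := by
  rw [← Real.sin_add_pi_div_two]; congr 1; push_cast; ring

theorem sin_even_mul_pi_div_two (r : ℕ) :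
    Real.sin (((2 * r : ℕ) : ℝ) * (Real.pi / 2)) = 0 := by
  rw [← Real.sin_nat_mul_pi r]; congr 1; push_cast; ring

namespace IsOrthogonalChain

variable {E : Type*} [NormedAddCommGroup E] [InnerProductSpace ℝ E] {r : ℕ} {F : ℕ → E}
  (hF : IsOrthogonalChain (2 * r + 1) F)
include hF

theorem sq_le_norm_chainOp_sub {w : E} (hw : inner ℝ (F (2 * r + 1)) w = 0) (ρ γ : ℝ) :
    γ ^ 2 ≤ ‖chainOp (2 * r + 1) ρ F w - γ • F 0‖ ^ 2 * ((2 * r + 1) / 2) := by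
  set p : ℕ → ℝ := fun j => Real.cos (j * (Real.pi / 2)) with hp
  set u := chainVec (2 * r + 1) F p with hu
  have hp0 : p 0 = 1 := by simp [hp]
  have hp1 : p 1 = 0 := by simp [hp]
  have hu2 : ‖u‖ ^ 2 = (2 * r + 1) / 2 := by
    rw [← real_inner_self_eq_norm_sq, hu, hF.inner_chainVec_chainVec]
    refine sum_sq_div_chainWeight (fun j => ?_) r
    simp only [hp]
    rw [cos_succ_mul_pi_div_two, neg_sq, Real.cos_sq_add_sin_sq]
  have h1 : inner ℝ (chainOp (2 * r + 1) ρ F w - γ • F 0) u = -γ := by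
    rw [inner_sub_left, inner_chainOp_comm, hu,
      hF.chainOp_chainVec (J := 2 * r) rfl ρ cos_add_two_mul_pi_div_two, inner_smul_left,
      hF.inner_chainVec p (Nat.zero_le _), hp0, hp1, zero_smul, zero_add, inner_smul_right,
      inner_smul_right, real_inner_comm, hw]
    simp
  have h2 := abs_real_inner_le_norm (chainOp (2 * r + 1) ρ F w - γ • F 0) u
  rw [h1, abs_neg] at h2
  calc γ ^ 2 = |γ| ^ 2 := (sq_abs γ).symm
    _ ≤ (‖chainOp (2 * r + 1) ρ F w - γ • F 0‖ * ‖u‖) ^ 2 := by gcongr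
    _ = _ := by rw [mul_pow, hu2]

theorem exists_minNorm_chainOp_eq {ρ γ : ℝ} (hρ : ρ ≠ 0) :
    ∃ x, chainOp (2 * r + 1) ρ F x = γ • F 0 ∧ ‖x‖ ^ 2 = (γ / ρ) ^ 2 * ((2 * r + 1) / 2) ∧
      ∀ w, chainOp (2 * r + 1) ρ F w = γ • F 0 → ‖x‖ ≤ ‖w‖ := by
  set q : ℕ → ℝ := fun j => Real.sin (j * (Real.pi / 2)) with hq
  set v := chainVec (2 * r + 1) F q with hv
  have hq1 : q 1 = 1 := by simp [hq]
  have hqr : ∀ i : ℕ, q (2 * i) = 0 := sin_even_mul_pi_div_two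
  have hTv : chainOp (2 * r + 1) ρ F ((γ / ρ) • v) = γ • F 0 := by
    rw [map_smul, hv, hF.chainOp_chainVec (J := 2 * r) rfl ρ sin_add_two_mul_pi_div_two, hq1,
      hqr, zero_smul, add_zero, one_smul, smul_smul, div_mul_cancel₀ _ hρ]
  refine ⟨(γ / ρ) • v, hTv, ?_, fun w hw => ?_⟩
  · rw [norm_smul, mul_pow, Real.norm_eq_abs, sq_abs, ← real_inner_self_eq_norm_sq, hv,
      hF.inner_chainVec_chainVec]
    congr 1
    refine sum_sq_div_chainWeight (fun j => ?_) r
    simp only [hq]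
    rw [sin_succ_mul_pi_div_two, Real.sin_sq_add_cos_sq]
  · set x := (γ / ρ) • v with hx
    have h0 : chainOp (2 * r + 1) ρ F (w - x) = 0 := by rw [map_sub, hw, hTv, sub_self]
    have horth : inner ℝ x (w - x) = 0 := by
      rw [hx, inner_smul_left, ← hx, hv, inner_chainVec_left, Finset.sum_eq_zero, mul_zero]
      -- Only odd members occur in `x`, and kernel vectors are orthogonal to those.
      intro j hj
      have := Finset.mem_range.1 hj
      obtain ⟨i, rfl | rfl⟩ := j.even_or_odd'
      · rw [hqr, zero_div, zero_mul]
      · rw [hF.inner_odd_of_chainOp_eq_zero hρ h0 i (by omega), mul_zero]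
    have h1 : ‖x‖ ^ 2 ≤ ‖w‖ ^ 2 := by
      have e : w = x + (w - x) := by abel
      have := norm_add_sq_eq_norm_sq_add_norm_sq_of_inner_eq_zero x (w - x) horth
      rw [← e] at this
      nlinarith [norm_nonneg (w - x)]
    exact (sq_le_sq₀ (norm_nonneg _) (norm_nonneg _)).1 h1

end IsOrthogonalChain

/-! ### New chain members orthogonal to given data. -/

theorem exists_ne_zero_forall_inner_eq_zero {n : ℕ} (S : Finset (Vec n)) (hS : S.card < n) :
    ∃ x : Vec n, x ≠ 0 ∧ ∀ s ∈ S, inner ℝ x s = 0 := by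
  have h : (Submodule.span ℝ (S : Set (Vec n)))ᗮ ≠ ⊥ := by
    rw [Ne, Submodule.orthogonal_eq_bot_iff]
    intro h
    have h1 := finrank_span_finset_le_card (R := ℝ) S
    rw [Set.finrank, h, finrank_top, finrank_euclideanSpace_fin] at h1
    omega
  obtain ⟨x, hx, hx0⟩ := Submodule.exists_mem_ne_zero_of_ne_bot h
  exact ⟨x, hx0, fun s hs =>
    Submodule.inner_left_of_mem_orthogonal (Submodule.subset_span hs) hx⟩

theorem exists_inner_self_eq_forall_inner_eq_zero {n : ℕ} (S : Finset (Vec n)) (hS : S.card < n)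
    {c : ℝ} (hc : 0 < c) : ∃ x : Vec n, inner ℝ x x = c ∧ ∀ s ∈ S, inner ℝ x s = 0 := by
  obtain ⟨x, hx, hxS⟩ := exists_ne_zero_forall_inner_eq_zero S hS
  have hx' : ‖x‖ ≠ 0 := norm_ne_zero_iff.2 hx
  refine ⟨(√c / ‖x‖) • x, ?_, fun s hs => by rw [inner_smul_left, hxS s hs, mul_zero]⟩
  rw [inner_smul_left, inner_smul_right, real_inner_self_eq_norm_sq]
  simp only [conj_trivial]
  field_simp
  exact Real.sq_sqrt hc.le

theorem exists_alternating_vec {n : ℕ} (S : Finset (Pt n)) (hS : S.card < n) {c : ℝ} (hc : 0 < c)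
    (j : ℕ) : ∃ v : Pt n, (Even j → v.fst = 0) ∧ (Odd j → v.snd = 0) ∧ inner ℝ v v = c ∧
      ∀ s ∈ S, inner ℝ v s = 0 := by
  classical
  rcases Nat.even_or_odd j with hj | hj
  · obtain ⟨y, hy, hyS⟩ := exists_inner_self_eq_forall_inner_eq_zero (S.image WithLp.snd)
      (Finset.card_image_le.trans_lt hS) hc
    refine ⟨mkPt 0 y, fun _ => rfl, fun h => absurd hj (Nat.not_even_iff_odd.2 h), ?_,
      fun s hs => ?_⟩
    · rw [inner_mkPt_zero_left]; exact hy
    · rw [real_inner_comm, inner_mkPt_zero_left, real_inner_comm]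
      exact hyS _ (Finset.mem_image_of_mem _ hs)
  · obtain ⟨x, hx, hxS⟩ := exists_inner_self_eq_forall_inner_eq_zero (S.image WithLp.fst)
      (Finset.card_image_le.trans_lt hS) hc
    refine ⟨mkPt x 0, fun h => absurd h (Nat.not_even_iff_odd.2 hj), fun _ => rfl, ?_,
      fun s hs => ?_⟩
    · rw [inner_mkPt_zero_right]; exact hx
    · rw [real_inner_comm, inner_mkPt_zero_right, real_inner_comm]
      exact hxS _ (Finset.mem_image_of_mem _ hs)

/-! ### The resisting oracle. -/

theorem BlackBoxAlgorithm.run_succ {n : ℕ} (A : BlackBoxAlgorithm n) (L : Pt n → ℝ) (z₀ : Pt n)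
    (i : ℕ) : A.run L z₀ (i + 1) =
      A i z₀ (fun j : Fin (i + 1) => gradOracle L (A.run L z₀ j.val).1) := by
  rw [BlackBoxAlgorithm.run]

theorem BlackBoxAlgorithm.run_zero {n : ℕ} (A : BlackBoxAlgorithm n) (L : Pt n → ℝ) (z₀ : Pt n) :
    A.run L z₀ 0 = (z₀, z₀) := by
  rw [BlackBoxAlgorithm.run]

theorem BlackBoxAlgorithm.run_congr {n : ℕ} (A : BlackBoxAlgorithm n) {L L' : Pt n → ℝ} (z₀ : Pt n)
    {j : ℕ} (h : ∀ i < j, gradOracle L' (A.run L z₀ i).1 = gradOracle L (A.run L z₀ i).1) :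
    ∀ i ≤ j, A.run L' z₀ i = A.run L z₀ i := by
  intro i
  induction i using Nat.strong_induction_on with
  | _ i ih =>
    intro hi
    cases i with
    | zero => rw [run_zero, run_zero]
    | succ i =>
      rw [run_succ, run_succ]
      congr 1
      funext l
      rw [ih l l.isLt (by omega), h l (by omega)]

/-- The biaffine objective attached to a family `F`. -/
noncomputable def chainObj {n : ℕ} (m : ℕ) (ρ γ : ℝ) (z₀ : Pt n) (F : ℕ → Pt n) : Pt n → ℝ :=
  quadObj (chainOp m ρ F) (γ • F 0) z₀

theorem IsAlternating.gradOracle_chainObj {n : ℕ} {F : ℕ → Pt n} (hF : IsAlternating F) (m : ℕ)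
    (ρ γ : ℝ) (z₀ z : Pt n) :
    gradOracle (chainObj m ρ γ z₀ F) z = chainOp m ρ F (z - z₀) - γ • F 0 :=
  (hF.isOffDiagonal m ρ).gradOracle_quadObj _ _ _

/-- Couplings from index `i` on vanish at `z`; the others involve only members up to `i`, where the
families agree. -/
theorem gradOracle_chainObj_congr {n : ℕ} {F F' : ℕ → Pt n} (hF : IsAlternating F)
    (hF' : IsAlternating F') (m : ℕ) (ρ γ : ℝ) {z₀ z : Pt n} {i : ℕ} (h : ∀ l ≤ i, F' l = F l)
    (hz : ∀ l ≥ i, inner ℝ (F l) (z - z₀) = 0) (hz' : ∀ l ≥ i, inner ℝ (F' l) (z - z₀) = 0) :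
    gradOracle (chainObj m ρ γ z₀ F') z = gradOracle (chainObj m ρ γ z₀ F) z := by
  rw [hF.gradOracle_chainObj, hF'.gradOracle_chainObj, h 0 (Nat.zero_le _), chainOp_apply,
    chainOp_apply]
  congr 2
  refine Finset.sum_congr rfl fun l _ => ?_
  rcases lt_or_ge l i with hl | hl
  · rw [h l hl.le, h (l + 1) hl]
  · rw [hz l hl, hz' l hl, hz (l + 1) (by omega), hz' (l + 1) (by omega)]
    simp

/-- `F` is a chain built up to index `j` whose objective the algorithm `A` has not explored:
the first `k` queries and the `k`-th approximate solution miss the later members of the chain. -/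
structure IsResistingChain {n : ℕ} (A : BlackBoxAlgorithm n) (m k : ℕ) (ρ γ : ℝ) (z₀ : Pt n)
    (j : ℕ) (F : ℕ → Pt n) : Prop extends IsAlternating F where
  eq_zero : ∀ l ≥ j, F l = 0
  orth : ∀ i l, i ≠ l → inner ℝ (F i) (F l) = 0
  inner_self : ∀ l < j, inner ℝ (F l) (F l) = chainWeight m l
  inner_inquiry : ∀ l, ∀ i ≤ l, i ≤ k →
    inner ℝ (F l) ((A.run (chainObj m ρ γ z₀ F) z₀ i).1 - z₀) = 0
  inner_approx : ∀ l ≥ k, inner ℝ (F l) ((A.run (chainObj m ρ γ z₀ F) z₀ k).2 - z₀) = 0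

/-- Filling in member `j` leaves the answers at queries before `j` intact, so the run is unchanged
up to query `j`. -/
theorem IsResistingChain.exists_succ {n : ℕ} {A : BlackBoxAlgorithm n} {m k : ℕ} {ρ γ : ℝ}
    {z₀ : Pt n} {j : ℕ} {F : ℕ → Pt n} (hF : IsResistingChain A m k ρ γ z₀ j F)
    (hj : j + k + 2 < n) : ∃ F', IsResistingChain A m k ρ γ z₀ (j + 1) F' := by
  classical
  set run := A.run (chainObj m ρ γ z₀ F) z₀
  -- All `k + 1` queries of the current run are avoided. Those after `j` may change under the new
  -- chain, but member `j` need not avoid them.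
  let S : Finset (Pt n) := insert ((run k).2 - z₀) ((Finset.range j).image F ∪
    (Finset.range (k + 1)).image fun i => (run i).1 - z₀)
  have hS : S.card < n := by
    have h1 := Finset.card_insert_le ((run k).2 - z₀) ((Finset.range j).image F ∪
      (Finset.range (k + 1)).image fun i => (run i).1 - z₀)
    have h2 := Finset.card_union_le ((Finset.range j).image F)
      ((Finset.range (k + 1)).image fun i => (run i).1 - z₀)
    have h3 := Finset.card_image_le (s := Finset.range j) (f := F)
    have h4 := Finset.card_image_le (s := Finset.range (k + 1)) (f := fun i => (run i).1 - z₀)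
    rw [Finset.card_range] at h3 h4
    change (insert _ _ : Finset (Pt n)).card < n
    omega
  obtain ⟨v, hv0, hv1, hvv, hvS⟩ := exists_alternating_vec S hS (chainWeight_pos m j) j
  have hvF : ∀ l < j, inner ℝ v (F l) = 0 := fun l hl => hvS _ (Finset.mem_insert_of_mem
    (Finset.mem_union_left _ (Finset.mem_image_of_mem F (Finset.mem_range.2 hl))))
  have hvI : ∀ i ≤ k, inner ℝ v ((run i).1 - z₀) = 0 := fun i hi => hvS _
    (Finset.mem_insert_of_mem (Finset.mem_union_right _ (Finset.mem_image_of_mem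
      (fun i => (run i).1 - z₀) (Finset.mem_range.2 (Nat.lt_succ_of_le hi)))))
  have hvA : inner ℝ v ((run k).2 - z₀) = 0 := hvS _ (Finset.mem_insert_self _ _)
  set F' := Function.update F j v
  have hself : F' j = v := Function.update_self ..
  have hne : ∀ l, l ≠ j → F' l = F l := fun l hl => Function.update_of_ne hl ..
  have hF'j : ∀ l, j < l → F' l = 0 := fun l hl => by
    rw [hne l hl.ne', hF.eq_zero l hl.le]
  have halt : IsAlternating F' := by
    constructor
    · intro l hl
      rcases eq_or_ne l j with rfl | h
      · rw [hself]; exact hv0 hl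
      · rw [hne l h]; exact hF.even l hl
    · intro l hl
      rcases eq_or_ne l j with rfl | h
      · rw [hself]; exact hv1 hl
      · rw [hne l h]; exact hF.odd l hl
  have hI : ∀ l, ∀ i ≤ l, i ≤ k → inner ℝ (F' l) ((run i).1 - z₀) = 0 := by
    intro l i hil hik
    rcases eq_or_ne l j with rfl | h
    · rw [hself]; exact hvI i hik
    · rw [hne l h]; exact hF.inner_inquiry l i hil hik
  have hA : ∀ l ≥ k, inner ℝ (F' l) ((run k).2 - z₀) = 0 := by
    intro l hl
    rcases eq_or_ne l j with rfl | h
    · rw [hself]; exact hvA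
    · rw [hne l h]; exact hF.inner_approx l hl
  have hagree : ∀ i ≤ min j k, A.run (chainObj m ρ γ z₀ F') z₀ i = run i := by
    refine A.run_congr z₀ fun i hi => ?_
    have hik : i ≤ k := hi.le.trans (min_le_right _ _)
    have hij : i < j := hi.trans_le (min_le_left _ _)
    exact gradOracle_chainObj_congr hF.toIsAlternating halt m ρ γ
      (fun l hl => hne l (by omega)) (fun l hl => hF.inner_inquiry l i hl hik)
      (fun l hl => hI l i hl hik)
  have hvF' : ∀ l, l ≠ j → inner ℝ v (F l) = 0 := fun l hl => by
    rcases lt_or_gt_of_ne hl with h | h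
    · exact hvF l h
    · rw [hF.eq_zero l h.le, inner_zero_right]
  refine ⟨F', ⟨halt, hF'j, ?_, ?_, ?_, ?_⟩⟩
  · intro i l hil
    rcases eq_or_ne i j with rfl | hi
    · rw [hself, hne l hil.symm]; exact hvF' l hil.symm
    · rcases eq_or_ne l j with rfl | hl
      · rw [hself, hne i hi, real_inner_comm]; exact hvF' i hi
      · rw [hne i hi, hne l hl]; exact hF.orth i l hil
  · intro l hl
    rcases eq_or_ne l j with rfl | h
    · rw [hself]; exact hvv
    · rw [hne l h]; exact hF.inner_self l (by omega)
  · intro l i hil hik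
    rcases le_or_gt l j with h | h
    · rw [hagree i (le_min (hil.trans h) hik)]; exact hI l i hil hik
    · rw [hF'j l h, inner_zero_left]
  · intro l hl
    rcases le_or_gt l j with h | h
    · rw [hagree k (le_min (le_trans hl h) le_rfl)]; exact hA l hl
    · rw [hF'j l h, inner_zero_left]

theorem exists_isResistingChain {n : ℕ} (A : BlackBoxAlgorithm n) (m k : ℕ) (ρ γ : ℝ)
    (z₀ : Pt n) (j : ℕ) (hj : j + k + 1 < n) : ∃ F, IsResistingChain A m k ρ γ z₀ j F := by
  induction j with
  | zero =>
    refine ⟨fun _ => 0, ⟨⟨fun _ _ => rfl, fun _ _ => rfl⟩, fun _ _ => rfl, ?_,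
      fun _ h => absurd h (Nat.not_lt_zero _), ?_, ?_⟩⟩ <;>
    simp only [inner_zero_left, implies_true]
  | succ j ih =>
    obtain ⟨F, hF⟩ := ih (by omega)
    exact hF.exists_succ (by omega)

/-! ### Choice of constants and conclusion. -/

theorem exists_resisting_objective {k n : ℕ} (hk : 1 ≤ k) (hn : 3 * k + 2 ≤ n) {R D : ℝ}
    (hR : 0 < R) (hD : 0 < D) (A : BlackBoxAlgorithm n) (z₀ : Pt n) :
    ∃ (L : Pt n → ℝ) (zs : Pt n),
      IsBiaffine L ∧ IsSmoothSaddle R L ∧ IsClosestSaddlePt L z₀ zs ∧ ‖z₀ - zs‖ = D ∧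
      R ^ 2 * ‖z₀ - zs‖ ^ 2 / (2 * ((k / 2 : ℕ) : ℝ) + 1) ^ 2 ≤
        ‖gradOracle L (A.inquiry L z₀ k)‖ ^ 2 ∧
      R ^ 2 * ‖z₀ - zs‖ ^ 2 / (2 * ((k / 2 : ℕ) : ℝ) + 1) ^ 2 ≤
        ‖gradOracle L (A.approx L z₀ k)‖ ^ 2 := by
  set r := k / 2 with hr
  have hM : (0 : ℝ) < 2 * r + 1 := by positivity
  -- Chosen so that the minimal-norm solution has norm `D`.
  set γ : ℝ := R * D / √(2 * (2 * r + 1)) with hγ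
  have hγ2 : γ ^ 2 = R ^ 2 * D ^ 2 / (2 * (2 * r + 1)) := by
    rw [hγ, div_pow, mul_pow, Real.sq_sqrt (by positivity)]
  obtain ⟨F, hF⟩ := exists_isResistingChain A (2 * r + 1) k (R / 2) γ z₀ (2 * r + 2) (by omega)
  have hC : IsOrthogonalChain (2 * r + 1) F :=
    ⟨hF.orth, fun j hj => hF.inner_self j (by omega)⟩
  have hT := hF.isOffDiagonal (2 * r + 1) (R / 2)
  obtain ⟨x, hx, hxn, hxmin⟩ := hC.exists_minNorm_chainOp_eq (ρ := R / 2) (γ := γ) (by positivity)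
  have hdist : ‖z₀ - (z₀ + x)‖ = D := by
    rw [sub_add_cancel_left, norm_neg, ← sq_eq_sq₀ (norm_nonneg _) hD.le, hxn, div_pow, hγ2]
    field_simp
  have hbound : ∀ z, inner ℝ (F (2 * r + 1)) (z - z₀) = 0 →
      R ^ 2 * ‖z₀ - (z₀ + x)‖ ^ 2 / (2 * (r : ℝ) + 1) ^ 2 ≤
        ‖gradOracle (chainObj (2 * r + 1) (R / 2) γ z₀ F) z‖ ^ 2 := by
    intro z hz
    have h := hC.sq_le_norm_chainOp_sub hz (R / 2) γ
    rw [hF.gradOracle_chainObj, hdist, div_le_iff₀ (by positivity)]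
    rw [hγ2, div_le_iff₀ (by positivity)] at h
    linarith
  refine ⟨chainObj (2 * r + 1) (R / 2) γ z₀ F, z₀ + x, hT.isBiaffine_quadObj _ _,
    hT.isSmoothSaddle_quadObj _ _ (hC.norm_chainOp_le hR), ⟨?_, ?_⟩, hdist, ?_, ?_⟩
  · exact hT.isSaddlePt_of_map_eq _ _ (by rw [add_sub_cancel_left, hx])
  · intro w hw
    rw [sub_add_cancel_left, norm_neg, norm_sub_rev]
    exact hxmin _ (hT.map_eq_of_isSaddlePt _ _ hw)
  -- `2⌊k/2⌋ + 1 ≥ k`, so the last member avoids query `k`.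
  · exact hbound _ (hF.inner_inquiry _ k (by omega) le_rfl)
  · exact hbound _ (hF.inner_approx _ (by omega))

theorem theorem4 (k n : ℕ) (hk : 1 ≤ k) (hn : 3 * k + 2 ≤ n) (R D : ℝ) (hR : 0 < R) (hD : 0 < D)
    (A : BlackBoxAlgorithm n) (z₀ : Pt n) :
    (∃ (L : Pt n → ℝ) (zs : Pt n),
      IsBiaffine L ∧ IsSmoothSaddle R L ∧ IsClosestSaddlePt L z₀ zs ∧ ‖z₀ - zs‖ = D ∧
      R ^ 2 * ‖z₀ - zs‖ ^ 2 / (2 * ((k / 2 : ℕ) : ℝ) + 1) ^ 2 ≤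
        ‖gradOracle L (BlackBoxAlgorithm.inquiry A L z₀ k)‖ ^ 2) ∧
    (∃ (L : Pt n → ℝ) (zs : Pt n),
      IsBiaffine L ∧ IsSmoothSaddle R L ∧ IsClosestSaddlePt L z₀ zs ∧ ‖z₀ - zs‖ = D ∧
      R ^ 2 * ‖z₀ - zs‖ ^ 2 / (2 * ((k / 2 : ℕ) : ℝ) + 1) ^ 2 ≤
        ‖gradOracle L (BlackBoxAlgorithm.approx A L z₀ k)‖ ^ 2) := by
  obtain ⟨L, zs, h1, h2, h3, h4, h5, h6⟩ := exists_resisting_objective hk hn hR hD A z₀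
  exact ⟨⟨L, zs, h1, h2, h3, h4, h5⟩, ⟨L, zs, h1, h2, h3, h4, h6⟩⟩
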